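/- Let $n,k\ge 0$ be integers and let $M\subset\mathbb{R}^n$ be a smooth domain with or without boundary: near each of its points $M$ is either a full neighbourhood of the point or of the form $\{\rho\ge 0\}$, with $\rho$ smooth, vanishing at the point and with $d\rho\neq 0$ there. Let $c=(c_{ijkl})$ be a stiffness tensor field of class $C^k$ on $M$ (all components are $C^k$ up to the part of the boundary contained in $M$), i.e. $c_{ijkl}=c_{jikl}=c_{klij}$, which is positive in the sense that the Christoffel matrix $$\Gamma_c(x,p)_{il}=\sum_{j,k}c_{ijkl}(x)\,p_jp_k$$ is positive definite for all $x\in M$ and $p\in\mathbb{R}^n\setminus\{0\}$ (this holds in particular if $c(x)$ is positive definite on symmetric matrices). Let $\lambda^c_{qP}(x,p)$ be the largest eigenvalue of $\Gamma_c(x,p)$. Suppose that the qP-branch of the slowness surface is globally separate: for every $x\in M$ and every $p$ with $\lambda^c_{qP}(x,p)=1$, the eigenvalue $1$ of $\Gamma_c(x,p)$ is simple. Then for every $x\in M$ the Legendre map $\ell_x:\mathbb{R}^n\to\mathbb{R}^n$, $\ell_x(p)=\tfrac12\nabla_p\lambda^c_{qP}(x,p)$ for $p\neq0$ and $\ell_x(0)=0$,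 is a bijection, and the qP Finsler function $$F^c_{qP}(x,v)=\lambda^c_{qP}\bigl(x,\ell_x^{-1}(v)\bigr)^{1/2}$$ is a Finsler function on $TM=M\times\mathbb{R}^n$: for each $x\in M$ it is nonnegative, vanishes exactly at $v=0$, is positively $1$-homogeneous in $v$, is smooth in $v\neq 0$, and for every $X\neq 0$ the form $g_{x,X}(Y,Z)=\frac12\frac{\partial^2}{\partial t\partial s}F^c_{qP}(x,X+sY+tZ)^2\big|_{s=t=0}$ is positive definite. Moreover $F^c_{qP}$ is $C^k$ along the manifold and smooth on the fibers, i.e. it belongs to the anisotropic class $C^k_\infty(TM\setminus 0)$, where $TM\setminus0=M\times(\mathbb{R}^n\setminus\{0\})$. Here $f\in C^k_\infty(TM\setminus 0)$ means that $f$ has continuous partial derivatives of all orders $\le k$ in $x$, and of all orders in $v$; that every $\partial_v^\alpha f$ has continuous partial derivatives of all orders $\le k$ in $x$; and that every $\partial_x^\beta f$ with $|\beta|\le k$ has continuous partial derivatives of all orders in $v$ (continuity is joint in $(x,v)\in TM\setminus 0$, derivatives in $x$ being taken within $M$). -/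

import Mathlib

noncomputable section

namespace Elastic

/-! ### Smooth domains -/

/-- A smooth domain `M ⊆ ℝⁿ`, with or without boundary: near each of its points, `M` is either
a full neighbourhood of the point or the superlevel set `{0 ≤ ρ}` of a smooth function `ρ` that
vanishes at the point and has nonzero differential there. -/
def IsSmoothDomain {n : ℕ} (M : Set (EuclideanSpace ℝ (Fin n))) : Prop :=
  ∀ x ∈ M, M ∈ nhds x ∨
    ∃ (W : Set (EuclideanSpace ℝ (Fin n))) (ρ : EuclideanSpace ℝ (Fin n) → ℝ),
      IsOpen W ∧ x ∈ W ∧ ContDiffOn ℝ ((⊤ : ℕ∞) : WithTop ℕ∞) ρ W ∧ ρ x = 0 ∧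
        fderiv ℝ ρ x ≠ 0 ∧ ∀ y ∈ W, (y ∈ M ↔ 0 ≤ ρ y)

/-! ### Stiffness tensors and the qP branch -/

/-- Arrays `c i j k l` of real numbers with `n ^ 4` components. -/
abbrev Tensor4 (n : ℕ) : Type := Fin n → Fin n → Fin n → Fin n → ℝ

/-- The elastic symmetries `c_ijkl = c_jikl = c_klij`. -/
def IsStiffnessTensor {n : ℕ} (c : Tensor4 n) : Prop :=
  ∀ i j k l, c i j k l = c j i k l ∧ c i j k l = c k l i j

/-- The Christoffel matrix `Γ_il(p) = ∑ j k, c_ijkl p_j p_k`. -/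
def christoffel {n : ℕ} (c : Tensor4 n) (p : EuclideanSpace ℝ (Fin n)) :
    Matrix (Fin n) (Fin n) ℝ :=
  Matrix.of fun i l => ∑ j, ∑ k, c i j k l * p j * p k

/-- Positivity of the stiffness tensor on rank-one strains: the Christoffel matrix of every
nonzero covector is positive definite, `∑ c_ijkl a_i p_j p_k a_l > 0` for `a ≠ 0`, `p ≠ 0`. -/
def IsStronglyElliptic {n : ℕ} (c : Tensor4 n) : Prop :=
  ∀ p : EuclideanSpace ℝ (Fin n), p ≠ 0 → (christoffel c p).PosDef

/-- The qP eigenvalue: the largest eigenvalue of the Christoffel matrix. -/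
def qPEigenvalue {n : ℕ} (c : Tensor4 n) (p : EuclideanSpace ℝ (Fin n)) : ℝ :=
  sSup (spectrum ℝ (christoffel c p))

/-- The slowness surface: the covectors `p` at which `1` is an eigenvalue of `Γ(p)`. -/
def slownessSurface {n : ℕ} (c : Tensor4 n) : Set (EuclideanSpace ℝ (Fin n)) :=
  {p | (christoffel c p).charpoly.eval 1 = 0}

/-- The qP branch of the slowness surface: there the eigenvalue `1` is the largest one. -/
def qPBranch {n : ℕ} (c : Tensor4 n) : Set (EuclideanSpace ℝ (Fin n)) :=
  {p ∈ slownessSurface c | qPEigenvalue c p = 1}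

/-- The qP branch meets no other branch of the slowness surface, over any point of `M`: at all of
its points the eigenvalue `1` of the Christoffel matrix is simple. -/
def QPBranchGloballySeparate {n : ℕ} (M : Set (EuclideanSpace ℝ (Fin n)))
    (c : EuclideanSpace ℝ (Fin n) → Tensor4 n) : Prop :=
  ∀ x ∈ M, ∀ p ∈ qPBranch (c x), (christoffel (c x) p).charpoly.rootMultiplicity 1 = 1

/-! ### The Legendre transform and the qP Finsler function -/

/-- The fibrewise Legendre map `p ↦ (∂H/∂p_1, …, ∂H/∂p_n)` of `H = λ_qP / 2`, with `0 ↦ 0`. -/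
def qPLegendre {n : ℕ} (c : Tensor4 n) (p : EuclideanSpace ℝ (Fin n)) :
    EuclideanSpace ℝ (Fin n) :=
  open Classical in
  if p = 0 then 0 else gradient (fun q => (1 / 2 : ℝ) * qPEigenvalue c q) p

/-- The qP Finsler function `F(x, v) = λ_qP(x, ℓ⁻¹ v) ^ (1/2)`, where `ℓ` is the Legendre map
over `x`. -/
def qPFinsler {n : ℕ} (c : EuclideanSpace ℝ (Fin n) → Tensor4 n)
    (x v : EuclideanSpace ℝ (Fin n)) : ℝ :=
  Real.sqrt (qPEigenvalue (c x) (Function.invFun (qPLegendre (c x)) v))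

/-- The fundamental tensor `g_X(Y, Z) = 1/2 ∂²/∂t∂s F(X + sY + tZ)²` at `s = t = 0` of a
function `F` on a fibre. -/
def fundamentalTensor {n : ℕ} (F : EuclideanSpace ℝ (Fin n) → ℝ)
    (X Y Z : EuclideanSpace ℝ (Fin n)) : ℝ :=
  (1 / 2 : ℝ) * deriv (fun t : ℝ => deriv (fun s : ℝ => F (X + s • Y + t • Z) ^ 2) 0) 0

/-- `F : TM = M × ℝⁿ → [0, ∞)` is a Finsler function on `M`. -/
def IsFinslerOn {n : ℕ} (M : Set (EuclideanSpace ℝ (Fin n)))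
    (F : EuclideanSpace ℝ (Fin n) → EuclideanSpace ℝ (Fin n) → ℝ) : Prop :=
  ∀ x ∈ M,
    (∀ X, 0 ≤ F x X) ∧
    (∀ X, F x X = 0 ↔ X = 0) ∧
    (∀ (r : ℝ) (X), 0 < r → F x (r • X) = r * F x X) ∧
    ContDiffOn ℝ ((⊤ : ℕ∞) : WithTop ℕ∞) (F x) {0}ᶜ ∧
    ∀ X, X ≠ 0 → ∀ Y, Y ≠ 0 → 0 < fundamentalTensor (F x) X Y Y

/-! ### Anisotropic regularity -/

/-- `f : V × U → W` is `k` times continuously differentiable in the first variable: the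
derivatives of order at most `k` in the first variable exist and are continuous on `V × U`. -/
def ContDiffFst {A B W : Type*} [NormedAddCommGroup A] [NormedSpace ℝ A]
    [NormedAddCommGroup B] [NormedSpace ℝ B] [NormedAddCommGroup W] [NormedSpace ℝ W]
    (k : ℕ∞) (f : A → B → W) (V : Set A) (U : Set B) : Prop :=
  (∀ u ∈ U, ContDiffOn ℝ (k : WithTop ℕ∞) (fun v => f v u) V) ∧
    ∀ m : ℕ, (m : ℕ∞) ≤ k →
      ContinuousOn (fun z : A × B => iteratedFDerivWithin ℝ m (fun v => f v z.2) V z.1) (V ×ˢ U)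

/-- `f : V × U → W` is `l` times continuously differentiable in the second variable: the
derivatives of order at most `l` in the second variable exist and are continuous on `V × U`. -/
def ContDiffSnd {A B W : Type*} [NormedAddCommGroup A] [NormedSpace ℝ A]
    [NormedAddCommGroup B] [NormedSpace ℝ B] [NormedAddCommGroup W] [NormedSpace ℝ W]
    (l : ℕ∞) (f : A → B → W) (V : Set A) (U : Set B) : Prop :=
  (∀ v ∈ V, ContDiffOn ℝ (l : WithTop ℕ∞) (fun u => f v u) U) ∧
    ∀ m : ℕ, (m : ℕ∞) ≤ l →
      ContinuousOn (fun z : A × B => iteratedFDerivWithin ℝ m (fun u => f z.1 u) U z.2) (V ×ˢ U)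

/-- The anisotropic regularity class `C^k_l(V × U; W)`. -/
def AnisotropicClass {A B W : Type*} [NormedAddCommGroup A] [NormedSpace ℝ A]
    [NormedAddCommGroup B] [NormedSpace ℝ B] [NormedAddCommGroup W] [NormedSpace ℝ W]
    (k l : ℕ∞) (f : A → B → W) (V : Set A) (U : Set B) : Prop :=
  ContDiffFst k f V U ∧ ContDiffSnd l f V U ∧
    (∀ m : ℕ, (m : ℕ∞) ≤ l →
      ContDiffFst (min k (l - (m : ℕ∞)))
        (fun v u => iteratedFDerivWithin ℝ m (fun u' => f v u') U u) V U) ∧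
    ∀ m : ℕ, (m : ℕ∞) ≤ k →
      ContDiffSnd (l - (m : ℕ∞))
        (fun v u => iteratedFDerivWithin ℝ m (fun v' => f v' u) V v) V U

end Elastic

end

/-!
For a tensor `c` with the elastic symmetries, `λ(p)` is the maximum over unit vectors `a` of the
quartic form `∑ c_ijkl a_i p_j p_k a_l`. The symmetry `c_ijkl = c_jilk` makes this form symmetric
under exchanging `a` and `p`, so for fixed `a` it is a positive definite quadratic form in `p`, and
`λ` is a maximum of such forms. Hence `λ` is strongly convex
(`IsSeparate.exists_add_rayleighForm_le`): its second derivative is positive definite wherever it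
exists, and the Legendre map `ℓ = ∇λ / 2` is strongly monotone. Injectivity of `ℓ` follows at once,
and surjectivity by minimising the coercive function `λ(p) - 2⟨v, p⟩`
(`IsSeparate.qPLegendre_bijective`).

Smoothness of `λ` away from `p = 0` comes from the implicit function theorem for the characteristic
polynomial at a simple root (`IsSeparate.contDiffAt_topRayleigh`). It is smoothness in the pair
`(c, p)`, where `c` ranges over the finite-dimensional space of all tensors. Since `Dℓ` is positive
definite, a second use of the implicit function theorem shows that `ℓ_c⁻¹(v)` is smooth in `(c, v)`
(`IsSeparate.exists_contDiffAt_legendreInv`). The square of the Finsler function is, up to constant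
factors, the convex conjugate of `λ / 2`, so that its gradient is `2ℓ⁻¹`, and its fundamental tensor
is the derivative of `ℓ⁻¹`, the inverse of a positive definite matrix
(`fundamentalTensor_qPFinsler`).

Regularity along the manifold thus reduces to composition: `F(x, v) = Φ(c(x), v)` with `Φ` smooth in
both arguments (`factorsLocally_qPFinsler`). Differentiating such a function in `v` replaces `Φ` by
another smooth function; differentiating it in `x` does the same, with `c` replaced by its jet, one
order less regular. This gives all the clauses of the anisotropic class
(`FactorsLocally.anisotropicClass`), once derivatives within `M` are unique
(`IsSmoothDomain.uniqueDiffOn`).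
-/

noncomputable section

open Set Filter Topology Metric
open scoped ContDiff RealInnerProductSpace

namespace Elastic

/-! ### Smooth domains have unique derivatives -/

/-- At a boundary point every vector `w` with `dρ(w) > 0` points into the domain, and such vectors
span the whole space. -/
theorem IsSmoothDomain.uniqueDiffOn {n : ℕ} {M : Set (EuclideanSpace ℝ (Fin n))}
    (hM : IsSmoothDomain M) : UniqueDiffOn ℝ M := by
  intro x hx
  rcases hM x hx with h | ⟨W, ρ, hW, hxW, hρ, hρx, hdρ, hMW⟩
  · exact uniqueDiffWithinAt_of_mem_nhds h
  have hd : HasFDerivAt ρ (fderiv ℝ ρ x) x :=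
    ((hρ.contDiffAt (hW.mem_nhds hxW)).differentiableAt (by simp)).hasFDerivAt
  have hcone : ∀ w, 0 < fderiv ℝ ρ x w → w ∈ tangentConeAt ℝ M x := by
    intro w hw
    have hlim : Tendsto (fun t : ℝ => t • w) (𝓝[>] 0) (𝓝 0) := by
      have : Tendsto (fun t : ℝ => t • w) (𝓝 0) (𝓝 ((0 : ℝ) • w)) :=
        (continuous_id.smul continuous_const).tendsto 0
      rw [zero_smul] at this
      exact this.mono_left nhdsWithin_le_nhds
    refine mem_tangentConeAt_of_seq (𝓝[>] (0 : ℝ)) (fun t => t⁻¹) (fun t => t • w) hlim ?_ ?_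
    · have hline : HasDerivAt (fun t : ℝ => ρ (x + t • w)) (fderiv ℝ ρ x w) 0 := by
        have h1 : HasDerivAt (fun t : ℝ => x + t • w) w 0 := by
          simpa using ((hasDerivAt_id (0 : ℝ)).smul_const w).const_add x
        have h2 : HasFDerivAt ρ (fderiv ℝ ρ x) (x + (0 : ℝ) • w) := by simpa using hd
        exact h2.comp_hasDerivAt 0 h1
      have hslope := hline.tendsto_slope_zero_right
      have hmem : ∀ᶠ t in 𝓝[>] (0 : ℝ), x + t • w ∈ W := by
        have : Tendsto (fun t : ℝ => x + t • w) (𝓝[>] 0) (𝓝 (x + 0)) := hlim.const_add x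
        rw [add_zero] at this
        exact this (hW.mem_nhds hxW)
      filter_upwards [hslope.eventually (lt_mem_nhds hw), hmem, self_mem_nhdsWithin] with t h1 h2 ht
      refine (hMW _ h2).2 ?_
      have ht' : (0 : ℝ) < t := ht
      simp only [zero_add, zero_smul, add_zero, hρx, sub_zero, smul_eq_mul] at h1
      exact (pos_of_mul_pos_right h1 (inv_pos.2 ht').le).le
    · refine tendsto_const_nhds.congr' ?_
      filter_upwards [self_mem_nhdsWithin] with t ht
      have ht' : t ≠ 0 := ne_of_gt ht
      rw [smul_smul, inv_mul_cancel₀ ht', one_smul]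
  obtain ⟨w₀, hw₀⟩ : ∃ w, 0 < fderiv ℝ ρ x w := by
    obtain ⟨w, hw⟩ : ∃ w, fderiv ℝ ρ x w ≠ 0 := by
      by_contra! h
      exact hdρ (ContinuousLinearMap.ext h)
    rcases lt_or_gt_of_ne hw with h | h
    · exact ⟨-w, by simpa using h⟩
    · exact ⟨w, h⟩
  refine ⟨?_, subset_closure hx⟩
  have hspan : Submodule.span ℝ (tangentConeAt ℝ M x) = ⊤ := by
    rw [eq_top_iff]
    intro y _
    -- `y = (y + s w₀) - s w₀`, and both terms point inwards once `s` is large.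
    obtain ⟨s, hs, hs'⟩ : ∃ s : ℝ, 0 < s ∧ 0 < fderiv ℝ ρ x (y + s • w₀) := by
      refine ⟨|fderiv ℝ ρ x y| / fderiv ℝ ρ x w₀ + 1, by positivity, ?_⟩
      rw [map_add, map_smul, smul_eq_mul, add_mul, div_mul_cancel₀ _ hw₀.ne', one_mul]
      linarith [neg_abs_le (fderiv ℝ ρ x y)]
    have h1 := Submodule.subset_span (R := ℝ) (hcone _ hs')
    have h2 := Submodule.smul_mem _ s (Submodule.subset_span (R := ℝ) (hcone _ hw₀))
    simpa using Submodule.sub_mem _ h1 h2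
  rw [hspan]
  simp

/-! ### Maps depending smoothly on a coefficient field -/

section FactorsLocally

variable {A B T W Z : Type} [NormedAddCommGroup A] [NormedSpace ℝ A]
  [NormedAddCommGroup B] [NormedSpace ℝ B] [NormedAddCommGroup T] [NormedSpace ℝ T]
  [NormedAddCommGroup W] [NormedSpace ℝ W] [NormedAddCommGroup Z] [NormedSpace ℝ Z]

/-- Near every point of `V × U`, the map `f` has the form `f x u = Φ (c x, u)` for a function `Φ`
that is smooth at the corresponding point; `Φ` may depend on the point. All dependence on `x` is
thus through the coefficient field `c`, whose regularity is not constrained. -/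
def FactorsLocally (c : A → T) (f : A → B → W) (V : Set A) (U : Set B) : Prop :=
  ∀ x ∈ V, ∀ u ∈ U, ∃ Φ : T × B → W, ContDiffAt ℝ ∞ Φ (c x, u) ∧
    ∀ᶠ z in 𝓝[V ×ˢ U] (x, u), f z.1 z.2 = Φ (c z.1, z.2)

variable {c : A → T} {f : A → B → W} {V : Set A} {U : Set B}

omit [NormedSpace ℝ A] [NormedSpace ℝ B] in
theorem tendsto_prodMk_left_nhdsWithin {x : A} {u : B} (hu : u ∈ U) :
    Tendsto (fun y => (y, u)) (𝓝[V] x) (𝓝[V ×ˢ U] (x, u)) := by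
  rw [nhdsWithin_prod_eq]
  exact tendsto_id.prodMk (tendsto_const_nhdsWithin hu)

omit [NormedSpace ℝ A] [NormedSpace ℝ B] in
theorem tendsto_prodMk_right_nhdsWithin {x : A} {u : B} (hx : x ∈ V) :
    Tendsto (fun w => (x, w)) (𝓝[U] u) (𝓝[V ×ˢ U] (x, u)) := by
  rw [nhdsWithin_prod_eq]
  exact (tendsto_const_nhdsWithin hx).prodMk tendsto_id

namespace FactorsLocally

omit [NormedSpace ℝ A] in
theorem congr {g : A → B → W} (hf : FactorsLocally c f V U)
    (h : ∀ x ∈ V, ∀ u ∈ U, g x u = f x u) : FactorsLocally c g V U := by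
  intro x hx u hu
  obtain ⟨Φ, hΦ, hfΦ⟩ := hf x hx u hu
  refine ⟨Φ, hΦ, ?_⟩
  filter_upwards [hfΦ, self_mem_nhdsWithin] with z hz hzm
  rw [h z.1 hzm.1 z.2 hzm.2, hz]

omit [NormedSpace ℝ A] in
theorem clm_comp (hf : FactorsLocally c f V U) (L : W →L[ℝ] Z) :
    FactorsLocally c (fun x u => L (f x u)) V U := by
  intro x hx u hu
  obtain ⟨Φ, hΦ, hfΦ⟩ := hf x hx u hu
  refine ⟨fun z => L (Φ z), L.contDiff.contDiffAt.comp _ hΦ, ?_⟩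
  filter_upwards [hfΦ] with z hz
  rw [hz]

theorem contDiffOn_fst {k : ℕ} (hf : FactorsLocally c f V U) (hc : ContDiffOn ℝ k c V) {u : B}
    (hu : u ∈ U) : ContDiffOn ℝ k (fun x => f x u) V := by
  intro x hx
  obtain ⟨Φ, hΦ, hfΦ⟩ := hf x hx u hu
  have h1 : ContDiffWithinAt ℝ k (fun y => Φ (c y, u)) V x :=
    ContDiffAt.comp_contDiffWithinAt (f := fun y => (c y, u)) x
      (hΦ.of_le (mod_cast le_top)) ((hc x hx).prodMk contDiffWithinAt_const)
  have h2 := (tendsto_prodMk_left_nhdsWithin (V := V) (x := x) hu).eventually hfΦ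
  exact h1.congr_of_eventuallyEq h2 (h2.self_of_nhdsWithin hx)

omit [NormedSpace ℝ A] in
theorem contDiffOn_snd (hf : FactorsLocally c f V U) {x : A} (hx : x ∈ V) :
    ContDiffOn ℝ ∞ (f x) U := by
  intro u hu
  obtain ⟨Φ, hΦ, hfΦ⟩ := hf x hx u hu
  have h1 : ContDiffWithinAt ℝ ∞ (fun w => Φ (c x, w)) U u :=
    ContDiffAt.comp_contDiffWithinAt (f := fun w => (c x, w)) u hΦ
      (contDiffWithinAt_const.prodMk contDiffWithinAt_id)
  have h2 := (tendsto_prodMk_right_nhdsWithin (U := U) (u := u) hx).eventually hfΦ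
  exact h1.congr_of_eventuallyEq h2 (h2.self_of_nhdsWithin hu)

omit [NormedSpace ℝ A] [NormedSpace ℝ B] [NormedSpace ℝ T] in
theorem tendsto_coefficient (hc : ContinuousOn c V) {x : A} (hx : x ∈ V) (u : B) :
    Tendsto (fun z : A × B => (c z.1, z.2)) (𝓝[V ×ˢ U] (x, u)) (𝓝 (c x, u)) := by
  have h1 : Tendsto (fun z : A × B => c z.1) (𝓝[V ×ˢ U] (x, u)) (𝓝 (c x)) :=
    (hc x hx).tendsto.comp (by rw [nhdsWithin_prod_eq]; exact tendsto_fst)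
  have h2 : Tendsto (fun z : A × B => z.2) (𝓝[V ×ˢ U] (x, u)) (𝓝 u) :=
    (continuous_snd.tendsto (x, u)).mono_left nhdsWithin_le_nhds
  exact h1.prodMk_nhds h2

omit [NormedSpace ℝ A] in
theorem continuousOn (hf : FactorsLocally c f V U) (hc : ContinuousOn c V) :
    ContinuousOn (fun z : A × B => f z.1 z.2) (V ×ˢ U) := by
  rintro ⟨x, u⟩ ⟨hx, hu⟩
  obtain ⟨Φ, hΦ, hfΦ⟩ := hf x hx u hu
  have h1 : Tendsto (fun z : A × B => Φ (c z.1, z.2)) (𝓝[V ×ˢ U] (x, u)) (𝓝 (Φ (c x, u))) :=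
    hΦ.continuousAt.tendsto.comp (tendsto_coefficient hc hx u)
  exact ContinuousWithinAt.congr_of_eventuallyEq h1 hfΦ (hfΦ.self_of_nhdsWithin ⟨hx, hu⟩)

theorem fderivWithin_fst (hf : FactorsLocally c f V U) (hV : UniqueDiffOn ℝ V)
    (hc : DifferentiableOn ℝ c V) :
    FactorsLocally (fun x => (c x, fderivWithin ℝ c V x))
      (fun x u => fderivWithin ℝ (fun y => f y u) V x) V U := by
  intro x hx u hu
  obtain ⟨Φ, hΦ, hfΦ⟩ := hf x hx u hu
  refine ⟨fun z => ((fderiv ℝ Φ (z.1.1, z.2)).comp (.inl ℝ T B)).comp z.1.2, ?_, ?_⟩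
  · have h1 : ContDiffAt ℝ ∞ (fun z : (T × (A →L[ℝ] T)) × B => fderiv ℝ Φ (z.1.1, z.2))
        ((c x, fderivWithin ℝ c V x), u) :=
      ContDiffAt.comp (g := fderiv ℝ Φ) (f := fun z : (T × (A →L[ℝ] T)) × B => (z.1.1, z.2))
        _ (hΦ.fderiv_right (m := ∞) (by simp)) (by fun_prop)
    exact (h1.clm_comp contDiffAt_const).clm_comp (by fun_prop)
  · have hdiff : ∀ᶠ z in 𝓝[V ×ˢ U] (x, u), DifferentiableAt ℝ Φ (c z.1, z.2) := by
      refine (tendsto_coefficient hc.continuousOn hx u).eventually ?_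
      filter_upwards [(hΦ.of_le (mod_cast le_top : ((1 : ℕ) : ℕ∞ω) ≤ ∞)).eventually (by simp)]
        with z hz using hz.differentiableAt (by simp)
    filter_upwards [eventually_eventually_nhdsWithin.2 hfΦ, hdiff, self_mem_nhdsWithin]
      with ⟨y, w⟩ h1 h2 ⟨hy, hw⟩
    have h3 : (fun y' => f y' w) =ᶠ[𝓝[V] y] fun y' => Φ (c y', w) :=
      (tendsto_prodMk_left_nhdsWithin (V := V) (x := y) hw).eventually h1
    have h4 : HasFDerivWithinAt (fun y' => Φ (c y', w)) _ V y :=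
      h2.hasFDerivAt.comp_hasFDerivWithinAt (f := fun y' => (c y', w)) y
        ((hc y hy).hasFDerivWithinAt.prodMk (hasFDerivWithinAt_const w y V))
    rw [h3.fderivWithin_eq (h3.self_of_nhdsWithin hy), h4.fderivWithin (hV y hy)]
    ext v
    simp

omit [NormedSpace ℝ A] in
theorem fderivWithin_snd (hf : FactorsLocally c f V U) (hU : UniqueDiffOn ℝ U)
    (hc : ContinuousOn c V) :
    FactorsLocally c (fun x u => fderivWithin ℝ (f x) U u) V U := by
  intro x hx u hu
  obtain ⟨Φ, hΦ, hfΦ⟩ := hf x hx u hu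
  refine ⟨fun z => (fderiv ℝ Φ z).comp (.inr ℝ T B),
    (hΦ.fderiv_right (m := ∞) (by simp)).clm_comp contDiffAt_const, ?_⟩
  have hdiff : ∀ᶠ z in 𝓝[V ×ˢ U] (x, u), DifferentiableAt ℝ Φ (c z.1, z.2) := by
    refine (tendsto_coefficient hc hx u).eventually ?_
    filter_upwards [(hΦ.of_le (mod_cast le_top : ((1 : ℕ) : ℕ∞ω) ≤ ∞)).eventually (by simp)]
      with z hz using hz.differentiableAt (by simp)
  filter_upwards [eventually_eventually_nhdsWithin.2 hfΦ, hdiff, self_mem_nhdsWithin]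
    with ⟨y, w⟩ h1 h2 ⟨hy, hw⟩
  have h3 : (fun w' => f y w') =ᶠ[𝓝[U] w] fun w' => Φ (c y, w') :=
    (tendsto_prodMk_right_nhdsWithin (U := U) (u := w) hy).eventually h1
  have h4 : HasFDerivWithinAt (fun w' => Φ (c y, w')) _ U w :=
    h2.hasFDerivAt.comp_hasFDerivWithinAt (f := fun w' => (c y, w')) w
      ((hasFDerivWithinAt_const (c y) w U).prodMk (hasFDerivWithinAt_id w U))
  refine (h3.fderivWithin_eq (h3.self_of_nhdsWithin hw)).trans
    ((h4.fderivWithin (hU w hw)).trans ?_)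
  ext v
  simp

/-- Each derivative in `x` costs one derivative of the coefficient field, which is enlarged by its
own derivatives. -/
theorem iteratedFDerivWithin_fst (hV : UniqueDiffOn ℝ V) {k : ℕ} (m : ℕ) :
    ∀ {T : Type} [NormedAddCommGroup T] [NormedSpace ℝ T] {c : A → T}
      {W : Type} [NormedAddCommGroup W] [NormedSpace ℝ W] {f : A → B → W},
      FactorsLocally c f V U → ContDiffOn ℝ (k + m : ℕ) c V →
      ∃ (T' : Type) (_ : NormedAddCommGroup T') (_ : NormedSpace ℝ T') (c' : A → T'),
        ContDiffOn ℝ k c' V ∧ FactorsLocally c'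
          (fun x u => iteratedFDerivWithin ℝ m (fun y => f y u) V x) V U := by
  induction m with
  | zero =>
    intro T _ _ c W _ _ f hf hc
    exact ⟨T, _, _, c, hc, (hf.clm_comp (continuousMultilinearCurryFin0 ℝ A
      W).symm.toContinuousLinearEquiv.toContinuousLinearMap).congr fun _ _ _ _ => rfl⟩
  | succ m ih =>
    intro T _ _ c W _ _ f hf hc
    have hc' : ContDiffOn ℝ (k + m : ℕ) (fun x => (c x, fderivWithin ℝ c V x)) V :=
      (hc.of_le (by exact_mod_cast Nat.le_succ _)).prodMk
        (hc.fderivWithin hV (by exact_mod_cast le_rfl))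
    have hd : DifferentiableOn ℝ c V := 
      hc.differentiableOn (by exact_mod_cast (k + m).succ_ne_zero)
    obtain ⟨T', _, _, c', hck, hfac⟩ := ih (hf.fderivWithin_fst hV hd) hc'
    refine ⟨T', _, _, c', hck, (hfac.clm_comp
      (continuousMultilinearCurryRightEquiv' ℝ m A
        W).symm.toContinuousLinearEquiv.toContinuousLinearMap).congr fun x hx u _ => ?_⟩
    rw [iteratedFDerivWithin_succ_eq_comp_right hV hx]
    rfl

omit [NormedSpace ℝ A] in
theorem iteratedFDerivWithin_snd (hU : UniqueDiffOn ℝ U) (hc : ContinuousOn c V) (m : ℕ) :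
    ∀ {W : Type} [NormedAddCommGroup W] [NormedSpace ℝ W] {f : A → B → W},
      FactorsLocally c f V U →
      FactorsLocally c (fun x u => iteratedFDerivWithin ℝ m (fun w => f x w) U u) V U := by
  induction m with
  | zero =>
    intro W _ _ f hf
    exact (hf.clm_comp (continuousMultilinearCurryFin0 ℝ B
      W).symm.toContinuousLinearEquiv.toContinuousLinearMap).congr fun _ _ _ _ => rfl
  | succ m ih =>
    intro W _ _ f hf
    refine ((ih (hf.fderivWithin_snd hU hc)).clm_comp
      (continuousMultilinearCurryRightEquiv' ℝ m B
        W).symm.toContinuousLinearEquiv.toContinuousLinearMap).congr fun x _ u hu => ?_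
    rw [iteratedFDerivWithin_succ_eq_comp_right hU hu]
    rfl

theorem contDiffFst (hV : UniqueDiffOn ℝ V) {k : ℕ} (hf : FactorsLocally c f V U)
    (hc : ContDiffOn ℝ k c V) : ContDiffFst (k : ℕ∞) f V U := by
  refine ⟨fun u hu => hf.contDiffOn_fst hc hu, fun m hm => ?_⟩
  have hmk : m ≤ k := by exact_mod_cast hm
  obtain ⟨T', _, _, c', hc', hfac⟩ := iteratedFDerivWithin_fst (k := k - m) hV m hf
    (by rwa [Nat.sub_add_cancel hmk])
  exact hfac.continuousOn hc'.continuousOn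

theorem contDiffSnd (hU : UniqueDiffOn ℝ U) (hf : FactorsLocally c f V U)
    (hc : ContinuousOn c V) : ContDiffSnd ⊤ f V U :=
  ⟨fun _ hx => hf.contDiffOn_snd hx,
    fun m _ => (iteratedFDerivWithin_snd hU hc m hf).continuousOn hc⟩

/-- A smooth function of a `C^k` coefficient field and of the fibre variable is of anisotropic class
`C^k_∞`. -/
theorem anisotropicClass (hV : UniqueDiffOn ℝ V) (hU : UniqueDiffOn ℝ U) {k : ℕ}
    (hf : FactorsLocally c f V U) (hc : ContDiffOn ℝ k c V) :
    AnisotropicClass (k : ℕ∞) ⊤ f V U := by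
  refine ⟨hf.contDiffFst hV hc, hf.contDiffSnd hU hc.continuousOn, fun m _ => ?_, fun m hm => ?_⟩
  · have : min (k : ℕ∞) (⊤ - (m : ℕ∞)) = k := by simp
    rw [this]
    exact (iteratedFDerivWithin_snd hU hc.continuousOn m hf).contDiffFst hV hc
  · have hmk : m ≤ k := by exact_mod_cast hm
    obtain ⟨T', _, _, c', hc', hfac⟩ := iteratedFDerivWithin_fst (k := k - m) hV m hf
      (by rwa [Nat.sub_add_cancel hmk])
    have : (⊤ : ℕ∞) - (m : ℕ∞) = ⊤ := by simp
    rw [this]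
    exact hfac.contDiffSnd hU hc'.continuousOn

end FactorsLocally

end FactorsLocally

/-! ### The quartic form of a stiffness tensor -/

variable {n : ℕ}

/-- The quartic form `∑ c_ijkl a_i p_j p_k a_l`, i.e. the quadratic form of the Christoffel matrix
of `p` evaluated at the polarisation `a`. -/
def rayleighForm (c : Tensor4 n) (a p : EuclideanSpace ℝ (Fin n)) : ℝ :=
  ∑ i, ∑ j, ∑ k, ∑ l, c i j k l * a i * p j * p k * a l

/-- The symmetric part of the Christoffel matrix. It is the Christoffel matrix itself for a
stiffness tensor, but it is available, and symmetric, for all arrays `c`. -/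
def symmChristoffel (c : Tensor4 n) (p : EuclideanSpace ℝ (Fin n)) : Matrix (Fin n) (Fin n) ℝ :=
  (1 / 2 : ℝ) • (christoffel c p + (christoffel c p).transpose)

/-- The symmetric part of the Christoffel matrix as an operator on Euclidean space. -/
def christoffelOp (c : Tensor4 n) (p : EuclideanSpace ℝ (Fin n)) :
    EuclideanSpace ℝ (Fin n) →L[ℝ] EuclideanSpace ℝ (Fin n) :=
  Matrix.toEuclideanCLM (𝕜 := ℝ) (symmChristoffel c p)

theorem rayleighForm_eq_dotProduct (c : Tensor4 n) (a p : EuclideanSpace ℝ (Fin n)) :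
    rayleighForm c a p = (a : Fin n → ℝ) ⬝ᵥ (christoffel c p).mulVec a := by
  simp only [rayleighForm, dotProduct, Matrix.mulVec, christoffel, Matrix.of_apply, Finset.mul_sum,
    Finset.sum_mul]
  refine Finset.sum_congr rfl fun i _ => ?_
  conv_rhs => rw [Finset.sum_comm]
  refine Finset.sum_congr rfl fun j _ => ?_
  conv_rhs => rw [Finset.sum_comm]
  exact Finset.sum_congr rfl fun k _ => Finset.sum_congr rfl fun l _ => by ring

theorem christoffelOp_isSelfAdjoint (c : Tensor4 n) (p : EuclideanSpace ℝ (Fin n)) :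
    IsSelfAdjoint (christoffelOp c p) := by
  have : IsSelfAdjoint (symmChristoffel c p) := by
    rw [← Matrix.isHermitian_iff_isSelfAdjoint]
    ext i l
    simp [symmChristoffel, mul_add, add_comm]
  exact this.map (Matrix.toEuclideanCLM (n := Fin n) (𝕜 := ℝ))

theorem rayleighForm_eq_inner (c : Tensor4 n) (a p : EuclideanSpace ℝ (Fin n)) :
    rayleighForm c a p = ⟪a, christoffelOp c p a⟫ := by
  rw [christoffelOp, Matrix.inner_toEuclideanCLM, symmChristoffel, Matrix.smul_mulVec,
    dotProduct_smul, Matrix.add_mulVec, dotProduct_add, Matrix.mulVec_transpose,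
    Matrix.dotProduct_mulVec _ (christoffel c p), dotProduct_comm (a : Fin n → ℝ) (_),
    rayleighForm_eq_dotProduct, Matrix.dotProduct_mulVec, smul_eq_mul]
  ring

theorem IsStiffnessTensor.rayleighForm_comm {c : Tensor4 n} (hc : IsStiffnessTensor c)
    (a p : EuclideanSpace ℝ (Fin n)) : rayleighForm c a p = rayleighForm c p a := by
  unfold rayleighForm
  rw [Finset.sum_comm]
  refine Finset.sum_congr rfl fun i _ => Finset.sum_congr rfl fun j _ => ?_
  rw [Finset.sum_comm]
  refine Finset.sum_congr rfl fun k _ => Finset.sum_congr rfl fun l _ => ?_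
  rw [show c j i l k = c i j k l by
    rw [(hc j i l k).1, (hc i j l k).2, (hc l k i j).1, (hc k l i j).2]]
  ring

theorem IsStiffnessTensor.christoffel_isSymm {c : Tensor4 n} (hc : IsStiffnessTensor c)
    (p : EuclideanSpace ℝ (Fin n)) : (christoffel c p).transpose = christoffel c p := by
  ext i l
  simp only [Matrix.transpose_apply, christoffel, Matrix.of_apply]
  rw [Finset.sum_comm]
  refine Finset.sum_congr rfl fun j _ => Finset.sum_congr rfl fun k _ => ?_
  rw [show c l k j i = c i j k l by
    rw [(hc l k j i).1, (hc k l j i).2, (hc j i k l).1]]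
  ring

theorem IsStiffnessTensor.symmChristoffel_eq {c : Tensor4 n} (hc : IsStiffnessTensor c)
    (p : EuclideanSpace ℝ (Fin n)) : symmChristoffel c p = christoffel c p := by
  rw [symmChristoffel, hc.christoffel_isSymm, ← two_smul ℝ, smul_smul]
  norm_num

theorem IsStronglyElliptic.rayleighForm_pos {c : Tensor4 n} (hc : IsStronglyElliptic c)
    {a p : EuclideanSpace ℝ (Fin n)} (ha : a ≠ 0) (hp : p ≠ 0) : 0 < rayleighForm c a p := by
  rw [rayleighForm_eq_dotProduct]
  have ha' : (a : Fin n → ℝ) ≠ 0 := fun h => ha (by ext i; simpa using congrFun h i)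
  simpa using (hc p hp).dotProduct_mulVec_pos ha'

theorem IsStronglyElliptic.rayleighForm_nonneg {c : Tensor4 n} (hc : IsStronglyElliptic c)
    {a : EuclideanSpace ℝ (Fin n)} (ha : a ≠ 0) (p : EuclideanSpace ℝ (Fin n)) :
    0 ≤ rayleighForm c a p := by
  rcases eq_or_ne p 0 with rfl | hp
  · simp [rayleighForm]
  · exact (hc.rayleighForm_pos ha hp).le

theorem rayleighForm_smul_right (c : Tensor4 n) (a p : EuclideanSpace ℝ (Fin n)) (r : ℝ) :
    rayleighForm c a (r • p) = r ^ 2 * rayleighForm c a p := by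
  simp only [rayleighForm, Finset.mul_sum, PiLp.smul_apply, smul_eq_mul]
  refine Finset.sum_congr rfl fun i _ => Finset.sum_congr rfl fun j _ =>
    Finset.sum_congr rfl fun k _ => Finset.sum_congr rfl fun l _ => by ring

theorem rayleighForm_smul_left (c : Tensor4 n) (a p : EuclideanSpace ℝ (Fin n)) (r : ℝ) :
    rayleighForm c (r • a) p = r ^ 2 * rayleighForm c a p := by
  simp only [rayleighForm, Finset.mul_sum, PiLp.smul_apply, smul_eq_mul]
  refine Finset.sum_congr rfl fun i _ => Finset.sum_congr rfl fun j _ =>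
    Finset.sum_congr rfl fun k _ => Finset.sum_congr rfl fun l _ => by ring

theorem continuous_rayleighForm : Continuous
    fun z : (Tensor4 n × EuclideanSpace ℝ (Fin n)) × EuclideanSpace ℝ (Fin n) =>
      rayleighForm z.1.1 z.2 z.1.2 := by
  unfold rayleighForm
  fun_prop

theorem continuous_rayleighForm_left (c : Tensor4 n) (p : EuclideanSpace ℝ (Fin n)) :
    Continuous fun a => rayleighForm c a p := by
  unfold rayleighForm
  fun_prop

/-! ### The largest eigenvalue as a maximum -/

/-- The maximum of the quadratic form of the Christoffel matrix over the unit sphere. Unlike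
`qPEigenvalue` it depends continuously on arbitrary arrays `c`, since it only sees the symmetric
part of the Christoffel matrix. -/
def topRayleigh (c : Tensor4 n) (p : EuclideanSpace ℝ (Fin n)) : ℝ :=
  sSup ((fun a => rayleighForm c a p) '' sphere 0 1)

theorem continuous_topRayleigh : Continuous
    fun z : Tensor4 n × EuclideanSpace ℝ (Fin n) => topRayleigh z.1 z.2 :=
  (isCompact_sphere (0 : EuclideanSpace ℝ (Fin n)) 1).continuous_sSup
    (f := fun (z : Tensor4 n × EuclideanSpace ℝ (Fin n)) a => rayleighForm z.1 a z.2)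
    continuous_rayleighForm

theorem rayleighForm_le_topRayleigh (c : Tensor4 n) (p : EuclideanSpace ℝ (Fin n))
    {a : EuclideanSpace ℝ (Fin n)} (ha : ‖a‖ = 1) : rayleighForm c a p ≤ topRayleigh c p := by
  have hcont := continuous_rayleighForm_left c p
  exact le_csSup ((isCompact_sphere _ _).bddAbove_image hcont.continuousOn)
    (mem_image_of_mem _ (by simpa using ha))

theorem exists_rayleighForm_eq_topRayleigh [Nontrivial (EuclideanSpace ℝ (Fin n))]
    (c : Tensor4 n) (p : EuclideanSpace ℝ (Fin n)) :
    ∃ a : EuclideanSpace ℝ (Fin n), ‖a‖ = 1 ∧ rayleighForm c a p = topRayleigh c p := by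
  have hcont := continuous_rayleighForm_left c p
  obtain ⟨a, ha, h, -⟩ :=
    (isCompact_sphere (0 : EuclideanSpace ℝ (Fin n)) 1).exists_sSup_image_eq_and_ge
      (NormedSpace.sphere_nonempty.2 zero_le_one) hcont.continuousOn
  exact ⟨a, by simpa using ha, h.symm⟩

theorem topRayleigh_smul (c : Tensor4 n) (p : EuclideanSpace ℝ (Fin n)) (r : ℝ) :
    topRayleigh c (r • p) = r ^ 2 * topRayleigh c p := by
  simp only [topRayleigh, rayleighForm_smul_right]
  rw [← smul_eq_mul, ← Real.sSup_smul_of_nonneg (sq_nonneg r), ← image_smul, image_image]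
  rfl

@[simp]
theorem topRayleigh_zero (c : Tensor4 n) : topRayleigh c (0 : EuclideanSpace ℝ (Fin n)) = 0 := by
  simpa using topRayleigh_smul c 0 0

theorem exists_eigenvector_topRayleigh [Nontrivial (EuclideanSpace ℝ (Fin n))]
    (c : Tensor4 n) (p : EuclideanSpace ℝ (Fin n)) :
    ∃ a : EuclideanSpace ℝ (Fin n), a ≠ 0 ∧ christoffelOp c p a = topRayleigh c p • a := by
  obtain ⟨a, ha, hR⟩ := exists_rayleighForm_eq_topRayleigh c p
  have ha0 : a ≠ 0 := by rintro rfl; simp at ha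
  refine ⟨a, ha0, ?_⟩
  have hmax : IsMaxOn (christoffelOp c p).reApplyInnerSelf (sphere 0 ‖a‖) a := by
    intro b hb
    have hb' : ‖b‖ = 1 := by simpa [ha] using hb
    simp only [mem_ofPred_eq, ContinuousLinearMap.reApplyInnerSelf_apply, RCLike.re_to_real]
    rw [real_inner_comm, real_inner_comm a, ← rayleighForm_eq_inner, ← rayleighForm_eq_inner, hR]
    exact rayleighForm_le_topRayleigh c p hb'
  rw [(christoffelOp_isSelfAdjoint c p).eq_smul_self_of_isLocalExtrOn_real (Or.inr hmax.localize),
    ContinuousLinearMap.rayleighQuotient, ContinuousLinearMap.reApplyInnerSelf_apply, ha,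
    RCLike.re_to_real, real_inner_comm, ← rayleighForm_eq_inner, hR]
  simp

/-- A scalar is a root of the characteristic polynomial if and only if it has an eigenvector. -/
theorem eval_charpoly_symmChristoffel_eq_zero_iff (c : Tensor4 n) (p : EuclideanSpace ℝ (Fin n))
    (t : ℝ) : (symmChristoffel c p).charpoly.eval t = 0 ↔
      ∃ a : EuclideanSpace ℝ (Fin n), a ≠ 0 ∧ christoffelOp c p a = t • a := by
  rw [Matrix.eval_charpoly, ← Matrix.exists_mulVec_eq_zero_iff]
  constructor
  · rintro ⟨v, hv, h⟩
    refine ⟨WithLp.toLp 2 v, fun h0 => hv (by simpa using congrArg WithLp.ofLp h0), ?_⟩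
    rw [Matrix.sub_mulVec, Matrix.scalar_apply, sub_eq_zero] at h
    rw [christoffelOp, Matrix.toEuclideanCLM_toLp, ← h]
    ext i
    simp
  · rintro ⟨a, ha, h⟩
    refine ⟨a, fun h0 => ha (by ext i; simpa using congrFun h0 i), ?_⟩
    have h' := congrArg WithLp.ofLp h
    rw [christoffelOp, Matrix.ofLp_toEuclideanCLM] at h'
    rw [Matrix.sub_mulVec, h', Matrix.scalar_apply]
    ext i
    simp

theorem eval_charpoly_topRayleigh [Nontrivial (EuclideanSpace ℝ (Fin n))]
    (c : Tensor4 n) (p : EuclideanSpace ℝ (Fin n)) :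
    (symmChristoffel c p).charpoly.eval (topRayleigh c p) = 0 :=
  (eval_charpoly_symmChristoffel_eq_zero_iff c p _).2 (exists_eigenvector_topRayleigh c p)

theorem IsStiffnessTensor.qPEigenvalue_eq {c : Tensor4 n} (hc : IsStiffnessTensor c)
    (p : EuclideanSpace ℝ (Fin n)) : qPEigenvalue c p = topRayleigh c p := by
  rcases subsingleton_or_nontrivial (EuclideanSpace ℝ (Fin n)) with hE | hE
  · -- In dimension zero both suprema are over the empty set.
    have hn : IsEmpty (Fin n) := by
      by_contra hn
      rw [not_isEmpty_iff] at hn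
      exact not_subsingleton (EuclideanSpace ℝ (Fin n)) hE
    have : Subsingleton (Matrix (Fin n) (Fin n) ℝ) := inferInstance
    rw [qPEigenvalue, topRayleigh, spectrum.of_subsingleton,
      sphere_eq_empty_of_subsingleton one_ne_zero, image_empty]
  have hspec : ∀ t, t ∈ spectrum ℝ (christoffel c p) ↔
      ∃ a : EuclideanSpace ℝ (Fin n), a ≠ 0 ∧ christoffelOp c p a = t • a := by
    intro t
    rw [Matrix.mem_spectrum_iff_not_isUnit_eval_charpoly, isUnit_iff_ne_zero, not_not,
      ← hc.symmChristoffel_eq, eval_charpoly_symmChristoffel_eq_zero_iff]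
  refine IsGreatest.csSup_eq ⟨(hspec _).2 (exists_eigenvector_topRayleigh c p), fun t ht => ?_⟩
  obtain ⟨a, ha, h⟩ := (hspec t).1 ht
  have ha' : 0 < ‖a‖ := norm_pos_iff.2 ha
  have h1 : rayleighForm c (‖a‖⁻¹ • a) p = t := by
    rw [rayleighForm_smul_left, rayleighForm_eq_inner, h, real_inner_smul_right,
      real_inner_self_eq_norm_sq]
    field_simp
  rw [← h1]
  exact rayleighForm_le_topRayleigh c p (by rw [norm_smul, norm_inv, norm_norm]; field_simp)

/-! ### Smoothness of a simple largest eigenvalue -/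

theorem isInvertible_of_injective {E : Type*} [NormedAddCommGroup E] [NormedSpace ℝ E]
    [FiniteDimensional ℝ E] (f : E →L[ℝ] E) (hf : Function.Injective f) : f.IsInvertible :=
  ⟨(LinearEquiv.ofInjectiveEndo (f : E →ₗ[ℝ] E) hf).toContinuousLinearEquiv,
    ContinuousLinearMap.ext fun _ => rfl⟩

theorem contDiff_eval_charpoly : ContDiff ℝ ∞
    fun z : (Tensor4 n × EuclideanSpace ℝ (Fin n)) × ℝ =>
      (symmChristoffel z.1.1 z.1.2).charpoly.eval z.2 := by
  have hentry : ∀ i j, ContDiff ℝ ∞ fun z : (Tensor4 n × EuclideanSpace ℝ (Fin n)) × ℝ =>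
      (Matrix.scalar (Fin n) z.2 - symmChristoffel z.1.1 z.1.2) i j := by
    intro i j
    have hdiag : ContDiff ℝ ∞ fun z : (Tensor4 n × EuclideanSpace ℝ (Fin n)) × ℝ =>
        Matrix.scalar (Fin n) z.2 i j := by
      rcases eq_or_ne i j with rfl | h
      · simpa using contDiff_snd
      · simpa [Matrix.diagonal_apply_ne _ h] using contDiff_const
    refine hdiag.sub ?_
    simp only [symmChristoffel, Matrix.smul_apply, Matrix.add_apply, Matrix.transpose_apply,
      christoffel, Matrix.of_apply]
    fun_prop
  simp only [Matrix.eval_charpoly, Matrix.det_apply']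
  exact ContDiff.sum fun σ _ => contDiff_const.mul (contDiff_prod fun i _ => hentry _ _)

/-- The implicit function theorem for the characteristic equation: near `(c₀, p₀)` it has exactly
one root near the largest eigenvalue, which by continuity is the largest eigenvalue. -/
theorem contDiffAt_topRayleigh_of_simple [Nontrivial (EuclideanSpace ℝ (Fin n))]
    {c₀ : Tensor4 n} {p₀ : EuclideanSpace ℝ (Fin n)}
    (h : (symmChristoffel c₀ p₀).charpoly.derivative.eval (topRayleigh c₀ p₀) ≠ 0) :
    ContDiffAt ℝ ∞ (fun z : Tensor4 n × EuclideanSpace ℝ (Fin n) => topRayleigh z.1 z.2)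
      (c₀, p₀) := by
  set f := fun z : (Tensor4 n × EuclideanSpace ℝ (Fin n)) × ℝ =>
      (symmChristoffel z.1.1 z.1.2).charpoly.eval z.2 with hf
  set u : (Tensor4 n × EuclideanSpace ℝ (Fin n)) × ℝ := ((c₀, p₀), topRayleigh c₀ p₀) with hu
  have hroot : ∀ z : Tensor4 n × EuclideanSpace ℝ (Fin n), f (z, topRayleigh z.1 z.2) = 0 :=
    fun z => eval_charpoly_topRayleigh z.1 z.2
  have cdf : ContDiffAt ℝ ∞ f u := contDiff_eval_charpoly.contDiffAt
  have hpartial : fderiv ℝ f u (0, 1) =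
      (symmChristoffel c₀ p₀).charpoly.derivative.eval (topRayleigh c₀ p₀) := by
    have h1 : HasDerivAt (fun t : ℝ => ((c₀, p₀), t))
        ((0, 1) : (Tensor4 n × EuclideanSpace ℝ (Fin n)) × ℝ) (topRayleigh c₀ p₀) :=
      (hasDerivAt_const _ _).prodMk (hasDerivAt_id _)
    have h2 : HasDerivAt (fun t : ℝ => f ((c₀, p₀), t)) _ (topRayleigh c₀ p₀) :=
      (symmChristoffel c₀ p₀).charpoly.hasDerivAt _
    exact ((cdf.differentiableAt (by simp)).hasFDerivAt.comp_hasDerivAt _ h1).unique h2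
  have if₂ : (fderiv ℝ f u ∘L .inr ℝ (Tensor4 n × EuclideanSpace ℝ (Fin n)) ℝ).IsInvertible := by
    refine isInvertible_of_injective _ ((injective_iff_map_eq_zero _).2 fun t ht => ?_)
    have h1 : ((0, t) : (Tensor4 n × EuclideanSpace ℝ (Fin n)) × ℝ) = t • (0, 1) := by simp
    rw [ContinuousLinearMap.comp_apply, ContinuousLinearMap.inr_apply, h1, map_smul, hpartial,
      smul_eq_mul] at ht
    exact (mul_eq_zero.1 ht).resolve_right h
  have hψ := cdf.contDiffAt_implicitFunction (by simp) if₂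
  refine hψ.congr_of_eventuallyEq ?_
  have hlim : Tendsto (fun z : Tensor4 n × EuclideanSpace ℝ (Fin n) => (z, topRayleigh z.1 z.2))
      (𝓝 (c₀, p₀)) (𝓝 u) :=
    (continuous_id.prodMk continuous_topRayleigh).tendsto (c₀, p₀)
  filter_upwards [hlim.eventually
    (cdf.eventually_apply_eq_iff_implicitFunction (by simp) if₂)] with z hz
  exact (hz.1 ((hroot z).trans (hroot (c₀, p₀)).symm)).symm

/-! ### Tensors with a globally separate qP branch -/

/-- The pointwise hypotheses on a stiffness tensor: the elastic symmetries, positivity, and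
simplicity of the eigenvalue `1` along the qP branch of the slowness surface. -/
structure IsSeparate (c : Tensor4 n) : Prop where
  stiffness : IsStiffnessTensor c
  elliptic : IsStronglyElliptic c
  simple : ∀ p ∈ qPBranch c, (christoffel c p).charpoly.rootMultiplicity 1 = 1

namespace IsSeparate

variable {c : Tensor4 n}

theorem topRayleigh_pos (hc : IsSeparate c) {p : EuclideanSpace ℝ (Fin n)} (hp : p ≠ 0) :
    0 < topRayleigh c p := by
  have : Nontrivial (EuclideanSpace ℝ (Fin n)) := ⟨p, 0, hp⟩
  obtain ⟨a, ha⟩ := exists_norm_eq (EuclideanSpace ℝ (Fin n)) zero_le_one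
  have ha0 : a ≠ 0 := by rintro rfl; simp at ha
  exact (hc.elliptic.rayleighForm_pos ha0 hp).trans_le (rayleighForm_le_topRayleigh c p ha)

theorem topRayleigh_nonneg (hc : IsSeparate c) (p : EuclideanSpace ℝ (Fin n)) :
    0 ≤ topRayleigh c p := by
  rcases eq_or_ne p 0 with rfl | hp
  · simp
  · exact (hc.topRayleigh_pos hp).le

theorem topRayleigh_eq_zero (hc : IsSeparate c) {p : EuclideanSpace ℝ (Fin n)} :
    topRayleigh c p = 0 ↔ p = 0 := by
  refine ⟨fun h => by_contra fun hp => (hc.topRayleigh_pos hp).ne' h, ?_⟩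
  rintro rfl
  simp

/-- The largest eigenvalue is a smooth function of the tensor and of the covector, first where it
equals `1`, then everywhere by homogeneity. -/
theorem contDiffAt_topRayleigh (hc : IsSeparate c) {p : EuclideanSpace ℝ (Fin n)} (hp : p ≠ 0) :
    ContDiffAt ℝ ∞ (fun z : Tensor4 n × EuclideanSpace ℝ (Fin n) => topRayleigh z.1 z.2)
      (c, p) := by
  have : Nontrivial (EuclideanSpace ℝ (Fin n)) := ⟨p, 0, hp⟩
  set s := Real.sqrt (topRayleigh c p) with hs
  have hs0 : 0 < s := Real.sqrt_pos.2 (hc.topRayleigh_pos hp)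
  have hs2 : s ^ 2 = topRayleigh c p := Real.sq_sqrt (hc.topRayleigh_pos hp).le
  have h1 : topRayleigh c (s⁻¹ • p) = 1 := by
    rw [topRayleigh_smul, ← hs2]
    field_simp
  have hroot : (christoffel c (s⁻¹ • p)).charpoly.eval 1 = 0 := by
    rw [← hc.stiffness.symmChristoffel_eq, ← h1]
    exact eval_charpoly_topRayleigh c _
  have hmult := hc.simple (s⁻¹ • p) ⟨hroot, by rw [hc.stiffness.qPEigenvalue_eq, h1]⟩
  have hsmooth := contDiffAt_topRayleigh_of_simple (c₀ := c) (p₀ := s⁻¹ • p) (by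
    rw [h1, hc.stiffness.symmChristoffel_eq]
    intro h
    have := (Polynomial.one_lt_rootMultiplicity_iff_isRoot
      (Matrix.charpoly_monic (christoffel c (s⁻¹ • p))).ne_zero).2 ⟨hroot, h⟩
    omega)
  have heq : (fun z : Tensor4 n × EuclideanSpace ℝ (Fin n) => topRayleigh z.1 z.2) =
      fun z => s ^ 2 * topRayleigh z.1 (s⁻¹ • z.2) := by
    ext z
    rw [topRayleigh_smul]
    field_simp
  rw [heq]
  exact contDiffAt_const.mul (hsmooth.comp (c, p)
    (f := fun z : Tensor4 n × EuclideanSpace ℝ (Fin n) => (z.1, s⁻¹ • z.2)) (by fun_prop))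

theorem differentiableAt_topRayleigh (hc : IsSeparate c) {p : EuclideanSpace ℝ (Fin n)}
    (hp : p ≠ 0) : DifferentiableAt ℝ (topRayleigh c) p :=
  ((hc.contDiffAt_topRayleigh hp).comp p (f := fun q => (c, q)) (by fun_prop)).differentiableAt
    (by simp)

end IsSeparate

/-! ### The Legendre map -/

@[simp]
theorem qPLegendre_zero (c : Tensor4 n) : qPLegendre c 0 = 0 := by simp [qPLegendre]

/-- The Legendre map as a function of the pair of tensor and covector, to which the implicit function
theorem applies. It is meaningful where `topRayleigh` is differentiable in both arguments. -/
def legendreMap (z : Tensor4 n × EuclideanSpace ℝ (Fin n)) : EuclideanSpace ℝ (Fin n) :=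
  (InnerProductSpace.toDual ℝ (EuclideanSpace ℝ (Fin n))).symm ((1 / 2 : ℝ) •
    (fderiv ℝ (fun w : Tensor4 n × EuclideanSpace ℝ (Fin n) => topRayleigh w.1 w.2) z ∘L
      .inr ℝ (Tensor4 n) (EuclideanSpace ℝ (Fin n))))

namespace IsSeparate

variable {c : Tensor4 n}

theorem contDiffAt_legendreMap (hc : IsSeparate c) {p : EuclideanSpace ℝ (Fin n)} (hp : p ≠ 0) :
    ContDiffAt ℝ ∞ legendreMap (c, p) := by
  have h := (hc.contDiffAt_topRayleigh hp).fderiv_right (m := ∞) (by simp)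
  exact (InnerProductSpace.toDual ℝ (EuclideanSpace ℝ (Fin n))).symm.contDiff.contDiffAt.comp _
    ((h.clm_comp contDiffAt_const).const_smul (1 / 2 : ℝ))

theorem legendreMap_eq (hc : IsSeparate c) {p : EuclideanSpace ℝ (Fin n)} (hp : p ≠ 0) :
    legendreMap (c, p) = qPLegendre c p := by
  have h1 : HasFDerivAt (topRayleigh c)
      (fderiv ℝ (fun w : Tensor4 n × EuclideanSpace ℝ (Fin n) => topRayleigh w.1 w.2) (c, p) ∘L
        .inr ℝ (Tensor4 n) (EuclideanSpace ℝ (Fin n))) p :=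
    (((hc.contDiffAt_topRayleigh hp).differentiableAt (by simp)).hasFDerivAt).comp p
      (hasFDerivAt_prodMk_right c p)
  have h2 : (fun q => (1 / 2 : ℝ) * qPEigenvalue c q) = fun q => (1 / 2 : ℝ) * topRayleigh c q :=
    funext fun q => by rw [hc.stiffness.qPEigenvalue_eq]
  rw [qPLegendre, if_neg hp, h2, gradient, (h1.const_mul (1 / 2 : ℝ)).fderiv, legendreMap]

theorem inner_qPLegendre (hc : IsSeparate c) {p : EuclideanSpace ℝ (Fin n)} (hp : p ≠ 0)
    (h : EuclideanSpace ℝ (Fin n)) :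
    2 * ⟪qPLegendre c p, h⟫ = fderiv ℝ (topRayleigh c) p h := by
  have h2 : (fun q => (1 / 2 : ℝ) * qPEigenvalue c q) = fun q => (1 / 2 : ℝ) * topRayleigh c q :=
    funext fun q => by rw [hc.stiffness.qPEigenvalue_eq]
  rw [qPLegendre, if_neg hp, h2, gradient, InnerProductSpace.toDual_symm_apply,
    ((hc.differentiableAt_topRayleigh hp).hasFDerivAt.const_mul (1 / 2 : ℝ)).fderiv]
  simp

/-- By the symmetry `c_ijkl = c_jilk` the quartic form, for a fixed polarisation `a`, is the
quadratic form of the Christoffel operator of `a` in the covector. -/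
theorem rayleighForm_expand (hc : IsSeparate c) (a p q : EuclideanSpace ℝ (Fin n)) :
    rayleighForm c a q = rayleighForm c a p + 2 * ⟪christoffelOp c a p, q - p⟫ +
      rayleighForm c a (q - p) := by
  simp only [hc.stiffness.rayleighForm_comm a, rayleighForm_eq_inner]
  have hsymm : ⟪p, christoffelOp c a q⟫ = ⟪christoffelOp c a p, q⟫ :=
    ((christoffelOp_isSelfAdjoint c a).isSymmetric p q).symm
  simp only [map_sub, inner_sub_left, inner_sub_right, hsymm]
  rw [real_inner_comm q (christoffelOp c a p), real_inner_comm p (christoffelOp c a p)]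
  ring

/-- The derivative of the maximum of the forms `rayleighForm c a` is that of the form which attains
it. -/
theorem qPLegendre_eq_christoffelOp (hc : IsSeparate c) {a p : EuclideanSpace ℝ (Fin n)}
    (ha : ‖a‖ = 1) (hmax : rayleighForm c a p = topRayleigh c p) :
    qPLegendre c p = christoffelOp c a p := by
  rcases eq_or_ne p 0 with rfl | hp
  · simp
  have h1 : HasFDerivAt (fun q => rayleighForm c a q) (2 • innerSL ℝ (christoffelOp c a p)) p := by
    have heq : (fun q => rayleighForm c a q) = (christoffelOp c a).reApplyInnerSelf := by
      ext q
      rw [hc.stiffness.rayleighForm_comm, rayleighForm_eq_inner,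
        ContinuousLinearMap.reApplyInnerSelf_apply, RCLike.re_to_real, real_inner_comm]
    rw [heq]
    exact ((christoffelOp_isSelfAdjoint c a).isSymmetric.hasStrictFDerivAt_reApplyInnerSelf
      p).hasFDerivAt
  have h2 := (hc.differentiableAt_topRayleigh hp).hasFDerivAt.sub h1
  have hmin : IsLocalMin (fun q => topRayleigh c q - rayleighForm c a q) p := by
    refine Eventually.of_forall fun q => ?_
    simp only [hmax, sub_self]
    exact sub_nonneg.2 (rayleighForm_le_topRayleigh c q ha)
  refine ext_inner_right ℝ fun w => ?_
  have h3 := DFunLike.congr_fun (hmin.hasFDerivAt_eq_zero h2) w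
  simp only [sub_apply, smul_apply, innerSL_apply_apply, nsmul_eq_mul, Nat.cast_ofNat,
    zero_apply, ← hc.inner_qPLegendre hp] at h3
  linarith

/-- Strong convexity of the largest eigenvalue, as a maximum of positive definite quadratic
forms. -/
theorem exists_add_rayleighForm_le (hc : IsSeparate c) [Nontrivial (EuclideanSpace ℝ (Fin n))]
    (p : EuclideanSpace ℝ (Fin n)) : ∃ a : EuclideanSpace ℝ (Fin n), a ≠ 0 ∧ ∀ q,
      topRayleigh c p + 2 * ⟪qPLegendre c p, q - p⟫ + rayleighForm c a (q - p)
        ≤ topRayleigh c q := by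
  obtain ⟨a, ha, hmax⟩ := exists_rayleighForm_eq_topRayleigh c p
  refine ⟨a, by rintro rfl; simp at ha, fun q => ?_⟩
  rw [hc.qPLegendre_eq_christoffelOp ha hmax, ← hmax, ← hc.rayleighForm_expand]
  exact rayleighForm_le_topRayleigh c q ha

/-- Euler's identity. -/
theorem inner_qPLegendre_self (hc : IsSeparate c) (p : EuclideanSpace ℝ (Fin n)) :
    ⟪qPLegendre c p, p⟫ = topRayleigh c p := by
  rcases subsingleton_or_nontrivial (EuclideanSpace ℝ (Fin n)) with hE | hE
  · simp [Subsingleton.elim p 0]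
  obtain ⟨a, ha, hmax⟩ := exists_rayleighForm_eq_topRayleigh c p
  rw [hc.qPLegendre_eq_christoffelOp ha hmax, ← hmax, hc.stiffness.rayleighForm_comm,
    rayleighForm_eq_inner, real_inner_comm]

theorem qPLegendre_smul (hc : IsSeparate c) (r : ℝ) (p : EuclideanSpace ℝ (Fin n)) :
    qPLegendre c (r • p) = r • qPLegendre c p := by
  rcases subsingleton_or_nontrivial (EuclideanSpace ℝ (Fin n)) with hE | hE
  · exact Subsingleton.elim _ _
  obtain ⟨a, ha, hmax⟩ := exists_rayleighForm_eq_topRayleigh c p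
  rw [hc.qPLegendre_eq_christoffelOp ha hmax, ← map_smul]
  exact hc.qPLegendre_eq_christoffelOp ha (by rw [rayleighForm_smul_right, topRayleigh_smul, hmax])

end IsSeparate

/-! ### Bijectivity of the Legendre map -/

namespace IsSeparate

variable {c : Tensor4 n}

/-- Strong monotonicity of the Legendre map. -/
theorem exists_rayleighForm_le_inner (hc : IsSeparate c)
    [Nontrivial (EuclideanSpace ℝ (Fin n))] (p : EuclideanSpace ℝ (Fin n)) :
    ∃ a : EuclideanSpace ℝ (Fin n), a ≠ 0 ∧ ∀ q,
      rayleighForm c a (q - p) ≤ 2 * ⟪qPLegendre c q - qPLegendre c p, q - p⟫ := by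
  obtain ⟨a, ha, h⟩ := hc.exists_add_rayleighForm_le p
  refine ⟨a, ha, fun q => ?_⟩
  obtain ⟨b, hb, h'⟩ := hc.exists_add_rayleighForm_le q
  have h1 := h q
  have h2 := h' p
  have h3 := hc.elliptic.rayleighForm_nonneg hb (p - q)
  rw [← neg_sub q p, inner_neg_right] at h2
  rw [inner_sub_left]
  rw [← neg_sub q p] at h3
  linarith

theorem qPLegendre_injective (hc : IsSeparate c) : Function.Injective (qPLegendre c) := by
  intro q p h
  by_contra hne
  have : Nontrivial (EuclideanSpace ℝ (Fin n)) := ⟨q, p, hne⟩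
  obtain ⟨a, ha, hle⟩ := hc.exists_rayleighForm_le_inner p
  have h1 := hle q
  rw [h, sub_self, inner_zero_left, mul_zero] at h1
  exact (hc.elliptic.rayleighForm_pos ha (sub_ne_zero.2 hne)).not_ge h1

theorem exists_mul_norm_sq_le (hc : IsSeparate c) :
    ∃ m : ℝ, 0 < m ∧ ∀ p : EuclideanSpace ℝ (Fin n), m * ‖p‖ ^ 2 ≤ topRayleigh c p := by
  rcases subsingleton_or_nontrivial (EuclideanSpace ℝ (Fin n)) with hE | hE
  · exact ⟨1, one_pos, fun p => by simp [Subsingleton.elim p 0]⟩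
  have hcont : Continuous (topRayleigh c) :=
    continuous_topRayleigh.comp (f := fun q => (c, q)) (by fun_prop)
  obtain ⟨e, he, hmin⟩ := (isCompact_sphere (0 : EuclideanSpace ℝ (Fin n)) 1).exists_isMinOn
    (NormedSpace.sphere_nonempty.2 zero_le_one) hcont.continuousOn
  refine ⟨topRayleigh c e, hc.topRayleigh_pos (ne_of_mem_sphere he one_ne_zero), fun p => ?_⟩
  rcases eq_or_ne p 0 with rfl | hp
  · simp
  have hp' : 0 < ‖p‖ := norm_pos_iff.2 hp
  have h1 : topRayleigh c e ≤ topRayleigh c (‖p‖⁻¹ • p) :=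
    hmin (by simp [norm_smul, hp'.ne'])
  rw [topRayleigh_smul, inv_pow, ← div_eq_inv_mul, le_div_iff₀ (by positivity)] at h1
  exact h1

/-- A preimage of `v` is found by minimising the coercive function `λ(p) - 2⟨v, p⟩`. -/
theorem qPLegendre_surjective (hc : IsSeparate c) : Function.Surjective (qPLegendre c) := by
  intro v
  rcases eq_or_ne v 0 with rfl | hv
  · exact ⟨0, qPLegendre_zero c⟩
  obtain ⟨m, hm, hle⟩ := hc.exists_mul_norm_sq_le
  have hcont : Continuous fun q => topRayleigh c q - 2 * ⟪v, q⟫ := by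
    have : Continuous (topRayleigh c) :=
      continuous_topRayleigh.comp (f := fun q => (c, q)) (by fun_prop)
    fun_prop
  obtain ⟨p, hp⟩ := hcont.exists_forall_le' 0 (by
    filter_upwards [tendsto_norm_cocompact_atTop.eventually_ge_atTop (2 * ‖v‖ / m)] with q hq
    have h1 := real_inner_le_norm v q
    have h2 := hle q
    rw [div_le_iff₀ hm] at hq
    have h3 : 2 * ‖v‖ * ‖q‖ ≤ ‖q‖ * m * ‖q‖ := by gcongr
    simp only [topRayleigh_zero, inner_zero_right, mul_zero, sub_zero]
    nlinarith)
  have hp0 : p ≠ 0 := by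
    -- Along the ray through `v` the linear term dominates near the origin.
    rintro rfl
    have hRv := hc.topRayleigh_pos hv
    have hv2 : 0 < ‖v‖ ^ 2 := by positivity
    have h := hp ((‖v‖ ^ 2 / topRayleigh c v) • v)
    rw [topRayleigh_smul, topRayleigh_zero, inner_zero_right, real_inner_smul_right,
      real_inner_self_eq_norm_sq] at h
    have h1 : (‖v‖ ^ 2 / topRayleigh c v) ^ 2 * topRayleigh c v
        - 2 * (‖v‖ ^ 2 / topRayleigh c v * ‖v‖ ^ 2) = -((‖v‖ ^ 2) ^ 2 / topRayleigh c v) := by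
      field_simp
      ring
    rw [h1] at h
    have : 0 < (‖v‖ ^ 2) ^ 2 / topRayleigh c v := by positivity
    linarith
  refine ⟨p, ext_inner_right ℝ fun w => ?_⟩
  have hmin : IsLocalMin (fun q => topRayleigh c q - 2 * ⟪v, q⟫) p := Eventually.of_forall hp
  have hd := (hc.differentiableAt_topRayleigh hp0).hasFDerivAt.sub
    (((innerSL ℝ v).hasFDerivAt (x := p)).const_mul 2)
  have h3 := DFunLike.congr_fun (hmin.hasFDerivAt_eq_zero hd) w
  simp only [sub_apply, smul_apply, innerSL_apply_apply, smul_eq_mul, zero_apply,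
    ← hc.inner_qPLegendre hp0] at h3
  linarith

theorem qPLegendre_bijective (hc : IsSeparate c) : Function.Bijective (qPLegendre c) :=
  ⟨hc.qPLegendre_injective, hc.qPLegendre_surjective⟩

end IsSeparate

/-! ### The inverse Legendre map -/

/-- The inverse of the Legendre map, a genuine two-sided inverse only when that map is bijective; this
is the `Function.invFun` occurring in `qPFinsler`. -/
def legendreInv (c : Tensor4 n) (v : EuclideanSpace ℝ (Fin n)) : EuclideanSpace ℝ (Fin n) :=
  Function.invFun (qPLegendre c) v

namespace IsSeparate

variable {c : Tensor4 n}

theorem qPLegendre_legendreInv (hc : IsSeparate c) (v : EuclideanSpace ℝ (Fin n)) :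
    qPLegendre c (legendreInv c v) = v :=
  Function.rightInverse_invFun hc.qPLegendre_surjective v

theorem legendreInv_qPLegendre (hc : IsSeparate c) (p : EuclideanSpace ℝ (Fin n)) :
    legendreInv c (qPLegendre c p) = p :=
  Function.leftInverse_invFun hc.qPLegendre_injective p

theorem legendreInv_eq_zero (hc : IsSeparate c) {v : EuclideanSpace ℝ (Fin n)} :
    legendreInv c v = 0 ↔ v = 0 := by
  constructor
  · intro h
    rw [← hc.qPLegendre_legendreInv v, h, qPLegendre_zero]
  · rintro rfl
    simpa using hc.legendreInv_qPLegendre 0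

theorem legendreInv_smul (hc : IsSeparate c) (r : ℝ) (v : EuclideanSpace ℝ (Fin n)) :
    legendreInv c (r • v) = r • legendreInv c v := by
  rw [← hc.legendreInv_qPLegendre (r • legendreInv c v), hc.qPLegendre_smul,
    hc.qPLegendre_legendreInv]

/-- The derivative of the Legendre map in the covector, half the Hessian of the largest eigenvalue,
is positive definite. -/
theorem inner_fderiv_legendreMap_pos (hc : IsSeparate c) {p h : EuclideanSpace ℝ (Fin n)}
    (hp : p ≠ 0) (hh : h ≠ 0) : 0 < ⟪fderiv ℝ legendreMap (c, p) (0, h), h⟫ := by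
  have : Nontrivial (EuclideanSpace ℝ (Fin n)) := ⟨p, 0, hp⟩
  obtain ⟨a, ha, hle⟩ := hc.exists_rayleighForm_le_inner p
  refine (half_pos (hc.elliptic.rayleighForm_pos ha hh)).trans_le ?_
  have hpath : HasDerivAt (fun t : ℝ => (c, p + t • h)) ((0, h) : Tensor4 n × _) 0 := by
    have h1 : HasDerivAt (fun t : ℝ => p + t • h) h 0 := by
      simpa using ((hasDerivAt_id (0 : ℝ)).smul_const h).const_add p
    exact (hasDerivAt_const _ _).prodMk h1
  have hL : HasFDerivAt legendreMap (fderiv ℝ legendreMap (c, p)) (c, p + (0 : ℝ) • h) := by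
    simpa using ((hc.contDiffAt_legendreMap hp).differentiableAt (by simp)).hasFDerivAt
  have hderiv : HasDerivAt (fun t : ℝ => legendreMap (c, p + t • h))
      (fderiv ℝ legendreMap (c, p) (0, h)) 0 :=
    HasFDerivAt.comp_hasDerivAt (l := legendreMap) (0 : ℝ) hL hpath
  have hlim := hderiv.tendsto_slope_zero_right.inner (𝕜 := ℝ) (tendsto_const_nhds (x := h))
  refine ge_of_tendsto hlim ?_
  have hne : ∀ᶠ t in 𝓝[>] (0 : ℝ), p + t • h ≠ 0 := by
    have hcont : ContinuousAt (fun t : ℝ => p + t • h) 0 := by fun_prop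
    exact (hcont.eventually_ne (by simpa using hp)).filter_mono nhdsWithin_le_nhds
  filter_upwards [hne, self_mem_nhdsWithin] with t ht ht0
  have ht0' : (0 : ℝ) < t := ht0
  have h1 := hle (p + t • h)
  rw [add_sub_cancel_left, rayleighForm_smul_right, real_inner_smul_right] at h1
  rw [zero_add, zero_smul, add_zero, hc.legendreMap_eq ht, hc.legendreMap_eq hp,
    real_inner_smul_left, ← div_eq_inv_mul, le_div_iff₀ ht0']
  nlinarith

/-- The inverse of the Legendre map is locally a smooth function of the tensor and of the vector,
as long as the tensor stays separate: the implicit function theorem provides a smooth local solution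
of `ℓ_c(p) = v`, and injectivity identifies it with the inverse. -/
theorem exists_contDiffAt_legendreInv (hc : IsSeparate c) {v : EuclideanSpace ℝ (Fin n)}
    (hv : v ≠ 0) : ∃ π : Tensor4 n × EuclideanSpace ℝ (Fin n) → EuclideanSpace ℝ (Fin n),
      ContDiffAt ℝ ∞ π (c, v) ∧
        ∀ᶠ z in 𝓝 (c, v), IsSeparate z.1 → legendreInv z.1 z.2 = π z := by
  set p := legendreInv c v with hp
  have hp0 : p ≠ 0 := fun h => hv (hc.legendreInv_eq_zero.1 h)
  set f := fun w : (Tensor4 n × EuclideanSpace ℝ (Fin n)) × EuclideanSpace ℝ (Fin n) =>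
    legendreMap (w.1.1, w.2) - w.1.2 with hf
  set u : (Tensor4 n × EuclideanSpace ℝ (Fin n)) × EuclideanSpace ℝ (Fin n) := ((c, v), p) with hu
  have hfu : f u = 0 := by
    simp only [hf, hu, hc.legendreMap_eq hp0]
    rw [hp, hc.qPLegendre_legendreInv, sub_self]
  have hL : ContDiffAt ℝ ∞ legendreMap (u.1.1, u.2) := hc.contDiffAt_legendreMap hp0
  have cdf : ContDiffAt ℝ ∞ f u :=
    (hL.comp u (f := fun w : (Tensor4 n × EuclideanSpace ℝ (Fin n)) × EuclideanSpace ℝ (Fin n) =>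
      (w.1.1, w.2)) (by fun_prop)).sub (by fun_prop)
  have hpartial : ∀ h, fderiv ℝ f u (0, h) = fderiv ℝ legendreMap (c, p) (0, h) := by
    intro h
    have h1 : HasFDerivAt f _ u :=
      (HasFDerivAt.comp (g := legendreMap) u (hL.differentiableAt (by simp)).hasFDerivAt
        ((hasFDerivAt_fst (p := u)).fst.prodMk hasFDerivAt_snd)).sub (hasFDerivAt_fst (p := u)).snd
    rw [h1.fderiv]
    simp [hu]
  have if₂ : (fderiv ℝ f u ∘L .inr ℝ (Tensor4 n × EuclideanSpace ℝ (Fin n))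
      (EuclideanSpace ℝ (Fin n))).IsInvertible := by
    refine isInvertible_of_injective _ ((injective_iff_map_eq_zero _).2 fun h hh => ?_)
    by_contra hne
    have h1 := hc.inner_fderiv_legendreMap_pos hp0 hne
    rw [ContinuousLinearMap.comp_apply, ContinuousLinearMap.inr_apply, hpartial] at hh
    rw [hh, inner_zero_left] at h1
    exact h1.false
  have hψ : ContDiffAt ℝ ∞ (cdf.implicitFunction (by simp) if₂) (c, v) :=
    cdf.contDiffAt_implicitFunction (by simp) if₂
  refine ⟨_, hψ, ?_⟩
  have hself : cdf.implicitFunction (by simp) if₂ (c, v) = p :=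
    cdf.implicitFunction_apply_self (by simp) if₂
  filter_upwards [cdf.eventually_apply_implicitFunction (by simp) if₂,
    hψ.continuousAt.eventually_ne (hself.symm ▸ hp0)] with z hz hne hzs
  rw [hfu] at hz
  have h1 := sub_eq_zero.1 hz
  rw [hzs.legendreMap_eq hne] at h1
  rw [← h1, hzs.legendreInv_qPLegendre]

theorem contDiffAt_legendreInv (hc : IsSeparate c) {v : EuclideanSpace ℝ (Fin n)} (hv : v ≠ 0) :
    ContDiffAt ℝ ∞ (legendreInv c) v := by
  obtain ⟨π, hπ, h⟩ := hc.exists_contDiffAt_legendreInv hv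
  have h1 : ContDiffAt ℝ ∞ (fun w => π (c, w)) v :=
    hπ.comp v (f := fun w => (c, w)) (by fun_prop)
  refine h1.congr_of_eventuallyEq ?_
  have h2 : Tendsto (fun w => (c, w)) (𝓝 v) (𝓝 (c, v)) :=
    (Continuous.prodMk_right c).tendsto v
  filter_upwards [h2.eventually h] with w hw using hw hc

theorem inner_fderiv_legendreInv_pos (hc : IsSeparate c) {v y : EuclideanSpace ℝ (Fin n)}
    (hv : v ≠ 0) (hy : y ≠ 0) : 0 < ⟪fderiv ℝ (legendreInv c) v y, y⟫ := by
  have hp0 : legendreInv c v ≠ 0 := fun h => hv (hc.legendreInv_eq_zero.1 h)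
  have hd := ((hc.contDiffAt_legendreInv hv).differentiableAt (by simp)).hasFDerivAt
  have hL := ((hc.contDiffAt_legendreMap hp0).differentiableAt (by simp)).hasFDerivAt
  have hcomp : HasFDerivAt (fun w => legendreMap (c, legendreInv c w)) _ v :=
    HasFDerivAt.comp (g := legendreMap) v hL ((hasFDerivAt_const c v).prodMk hd)
  have hid : (fun w => legendreMap (c, legendreInv c w)) =ᶠ[𝓝 v] id := by
    filter_upwards [eventually_ne_nhds hv] with w hw
    rw [hc.legendreMap_eq fun h => hw (hc.legendreInv_eq_zero.1 h), hc.qPLegendre_legendreInv, id]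
  have hinv := DFunLike.congr_fun (hcomp.unique ((hasFDerivAt_id v).congr_of_eventuallyEq hid)) y
  simp only [ContinuousLinearMap.comp_apply, ContinuousLinearMap.prod_apply, zero_apply,
    ContinuousLinearMap.id_apply] at hinv
  have hne : fderiv ℝ (legendreInv c) v y ≠ 0 := by
    intro h
    rw [h] at hinv
    exact hy (by rw [← hinv, Prod.mk_zero_zero, map_zero])
  have hpos := hc.inner_fderiv_legendreMap_pos hp0 hne
  rwa [hinv, real_inner_comm] at hpos

/-! ### The qP Finsler function -/

theorem hasFDerivAt_topRayleigh_legendreInv (hc : IsSeparate c) {v : EuclideanSpace ℝ (Fin n)}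
    (hv : v ≠ 0) : HasFDerivAt (fun w => topRayleigh c (legendreInv c w))
      ((2 : ℝ) • innerSL ℝ (legendreInv c v)) v := by
  have : Nontrivial (EuclideanSpace ℝ (Fin n)) := ⟨v, 0, hv⟩
  have hp0 : legendreInv c v ≠ 0 := fun h => hv (hc.legendreInv_eq_zero.1 h)
  have hd : DifferentiableAt ℝ (fun w => topRayleigh c (legendreInv c w)) v :=
    (hc.differentiableAt_topRayleigh hp0).comp v
      ((hc.contDiffAt_legendreInv hv).differentiableAt (by simp))
  -- Up to the factor `2` the function is the convex conjugate of `λ / 2`, hence bounded from below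
  -- by the affine function with slope `ℓ⁻¹(v)` that agrees with it at `v`.
  have hmin : IsLocalMin (fun w => topRayleigh c (legendreInv c w) -
      2 * ⟪legendreInv c v, w⟫) v := by
    refine Eventually.of_forall fun w => ?_
    obtain ⟨a, ha, hle⟩ := hc.exists_add_rayleighForm_le (legendreInv c w)
    have h1 := hle (legendreInv c v)
    have h2 := hc.elliptic.rayleighForm_nonneg ha (legendreInv c v - legendreInv c w)
    have h3 := hc.inner_qPLegendre_self (legendreInv c w)
    have h4 := hc.inner_qPLegendre_self (legendreInv c v)
    rw [hc.qPLegendre_legendreInv] at h1 h3 h4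
    rw [inner_sub_right, h3] at h1
    simp only [real_inner_comm _ (legendreInv c v), h4]
    linarith
  have hdiff := hd.hasFDerivAt.sub (((innerSL ℝ (legendreInv c v)).hasFDerivAt (x := v)).const_mul 2)
  have h0 := sub_eq_zero.1 (hmin.hasFDerivAt_eq_zero hdiff)
  rw [← h0]
  exact hd.hasFDerivAt

end IsSeparate

variable {c : EuclideanSpace ℝ (Fin n) → Tensor4 n} {x : EuclideanSpace ℝ (Fin n)}

theorem qPFinsler_eq (hc : IsSeparate (c x)) (v : EuclideanSpace ℝ (Fin n)) :
    qPFinsler c x v = Real.sqrt (topRayleigh (c x) (legendreInv (c x) v)) := by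
  rw [qPFinsler, hc.stiffness.qPEigenvalue_eq, legendreInv]

theorem qPFinsler_sq (hc : IsSeparate (c x)) (v : EuclideanSpace ℝ (Fin n)) :
    qPFinsler c x v ^ 2 = topRayleigh (c x) (legendreInv (c x) v) := by
  rw [qPFinsler_eq hc, Real.sq_sqrt (hc.topRayleigh_nonneg _)]

theorem fundamentalTensor_qPFinsler (hc : IsSeparate (c x)) {X : EuclideanSpace ℝ (Fin n)}
    (hX : X ≠ 0) (Y Z : EuclideanSpace ℝ (Fin n)) :
    fundamentalTensor (qPFinsler c x) X Y Z = ⟪fderiv ℝ (legendreInv (c x)) X Z, Y⟫ := by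
  have hline : HasDerivAt (fun t : ℝ => X + t • Z) Z 0 := by
    simpa using ((hasDerivAt_id (0 : ℝ)).smul_const Z).const_add X
  have hinner : (fun t : ℝ => deriv (fun s : ℝ => qPFinsler c x (X + s • Y + t • Z) ^ 2) 0)
      =ᶠ[𝓝 0] fun t => 2 * ⟪legendreInv (c x) (X + t • Z), Y⟫ := by
    filter_upwards [hline.continuousAt.eventually_ne (by simpa using hX)] with t ht
    have h1 : HasDerivAt (fun s : ℝ => X + s • Y + t • Z) Y 0 := by
      simpa using (((hasDerivAt_id (0 : ℝ)).smul_const Y).const_add X).add_const (t • Z)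
    have h2 : HasFDerivAt (fun w => topRayleigh (c x) (legendreInv (c x) w))
        ((2 : ℝ) • innerSL ℝ (legendreInv (c x) (X + t • Z))) (X + (0 : ℝ) • Y + t • Z) := by
      simpa using hc.hasFDerivAt_topRayleigh_legendreInv ht
    simp only [qPFinsler_sq hc]
    have h3 := (h2.comp_hasDerivAt (0 : ℝ) h1).deriv
    simpa [Function.comp_def] using h3
  have hd : HasFDerivAt (legendreInv (c x)) (fderiv ℝ (legendreInv (c x)) X)
      (X + (0 : ℝ) • Z) := by
    simpa using ((hc.contDiffAt_legendreInv hX).differentiableAt (by simp)).hasFDerivAt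
  have houter : HasDerivAt (fun t : ℝ => 2 * ⟪legendreInv (c x) (X + t • Z), Y⟫)
      (2 * ⟪fderiv ℝ (legendreInv (c x)) X Z, Y⟫) 0 := by
    have h1 : HasDerivAt (fun t : ℝ => legendreInv (c x) (X + t • Z))
        (fderiv ℝ (legendreInv (c x)) X Z) 0 := hd.comp_hasDerivAt (0 : ℝ) hline
    simpa using (h1.inner ℝ (hasDerivAt_const (0 : ℝ) Y)).const_mul 2
  rw [fundamentalTensor, hinner.deriv_eq, houter.deriv]
  ring

/-- Through the coefficient field `c` the qP Finsler function depends smoothly on its arguments. -/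
theorem factorsLocally_qPFinsler {M : Set (EuclideanSpace ℝ (Fin n))}
    (hc : ∀ x ∈ M, IsSeparate (c x)) (hcont : ContinuousOn c M) :
    FactorsLocally c (qPFinsler c) M {0}ᶜ := by
  intro x hx v hv
  have hv0 : v ≠ 0 := hv
  obtain ⟨π, hπ, h⟩ := (hc x hx).exists_contDiffAt_legendreInv hv0
  have hπv : legendreInv (c x) v = π (c x, v) := h.self_of_nhds (hc x hx)
  have hp0 : π (c x, v) ≠ 0 := fun h0 =>
    hv0 ((hc x hx).legendreInv_eq_zero.1 (hπv.trans h0))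
  refine ⟨fun z => Real.sqrt (topRayleigh z.1 (π z)), ?_, ?_⟩
  · have h1 : ContDiffAt ℝ ∞ (fun z : Tensor4 n × EuclideanSpace ℝ (Fin n) =>
        topRayleigh z.1 (π z)) (c x, v) :=
      ((hc x hx).contDiffAt_topRayleigh hp0).comp (c x, v) (f := fun z => (z.1, π z))
        (contDiffAt_fst.prodMk hπ)
    exact h1.sqrt ((hc x hx).topRayleigh_pos hp0).ne'
  · filter_upwards [(FactorsLocally.tendsto_coefficient hcont hx v).eventually h,
      self_mem_nhdsWithin] with z hz hzm
    rw [qPFinsler_eq (hc _ hzm.1), hz (hc _ hzm.1)]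

end Elastic

end

theorem theorem1 (n k : ℕ) (M : Set (EuclideanSpace ℝ (Fin n)))
    (hM : Elastic.IsSmoothDomain M)
    (c : EuclideanSpace ℝ (Fin n) → Elastic.Tensor4 n)
    (hsymm : ∀ x ∈ M, Elastic.IsStiffnessTensor (c x))
    (hpos : ∀ x ∈ M, Elastic.IsStronglyElliptic (c x))
    (hc : ∀ i j r l, ContDiffOn ℝ (k : WithTop ℕ∞) (fun x => c x i j r l) M)
    (hsep : Elastic.QPBranchGloballySeparate M c) :
    (∀ x ∈ M, Function.Bijective (Elastic.qPLegendre (c x))) ∧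
      Elastic.IsFinslerOn M (Elastic.qPFinsler c) ∧
      Elastic.AnisotropicClass (k : ℕ∞) (⊤ : ℕ∞) (Elastic.qPFinsler c) M {0}ᶜ := by
  have hS : ∀ x ∈ M, Elastic.IsSeparate (c x) := fun x hx => ⟨hsymm x hx, hpos x hx, hsep x hx⟩
  have hck : ContDiffOn ℝ k c M := contDiffOn_pi.2 fun i => contDiffOn_pi.2 fun j =>
    contDiffOn_pi.2 fun r => contDiffOn_pi.2 fun l => hc i j r l
  have hfac := Elastic.factorsLocally_qPFinsler hS hck.continuousOn
  refine ⟨fun x hx => (hS x hx).qPLegendre_bijective, fun x hx => ⟨fun X => Real.sqrt_nonneg _,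
    fun X => ?_, fun r X hr => ?_, hfac.contDiffOn_snd hx, fun X hX Y hY => ?_⟩,
    hfac.anisotropicClass hM.uniqueDiffOn isOpen_compl_singleton.uniqueDiffOn hck⟩
  · rw [Elastic.qPFinsler_eq (hS x hx), Real.sqrt_eq_zero ((hS x hx).topRayleigh_nonneg _),
      (hS x hx).topRayleigh_eq_zero, (hS x hx).legendreInv_eq_zero]
  · rw [Elastic.qPFinsler_eq (hS x hx), Elastic.qPFinsler_eq (hS x hx),
      (hS x hx).legendreInv_smul, Elastic.topRayleigh_smul, Real.sqrt_mul (sq_nonneg r),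
      Real.sqrt_sq hr.le]
  · rw [Elastic.fundamentalTensor_qPFinsler (hS x hx) hX]
    exact (hS x hx).inner_fderiv_legendreInv_pos hX hY
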